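/- **Conventions.** For $N\in\mathbb Z_{\ge 0}$ let $\mathcal T_N$ be the operator that sets to zero all entries of a sequence $x:\mathbb Z\to\mathbb C$ with index outside $\{0,\dots,N-1\}$. For $0\le W\le \tfrac12$ let $\mathcal B_W$ be the band-limiting operator $$(\mathcal B_W x)(n)=\int_{-W}^{W}\Big(\sum_{k\in\mathbb Z}x(k)e^{-2\pi i f k}\Big)e^{2\pi i f n}\,df$$ (only applied here to finitely supported $x$). The discrete prolate spheroidal sequences (DPSSs) with parameters $N,W$ are real sequences $s^{(0)}_{N,W},\dots,s^{(N-1)}_{N,W}$ on $\mathbb Z$ which, with eigenvalues $1>\lambda^{(0)}_{N,W}>\dots>\lambda^{(N-1)}_{N,W}>0$, satisfy $\mathcal B_W\mathcal T_N s^{(\ell)}_{N,W}=\lambda^{(\ell)}_{N,W}s^{(\ell)}_{N,W}$ and $\|\mathcal T_N s^{(\ell)}_{N,W}\|_2=1$. The DPSS vectors $\mathbf s^{(\ell)}_{N,W}\in\mathbb R^N$ are their restrictions to $\{0,\dots,N-1\}$. For an integer $L$ and $0<\epsilon<L-1$, put $W=\frac1{2L}$. Call $(C_3,C_4,N_1)$,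 with $C_3,C_4\in\mathbb R$ and $N_1\in\mathbb Z_{\ge0}$, *decay constants for $(L,\epsilon)$* if for every $N\ge N_1$, for all DPSSs with parameters $N,W$, $$\lambda^{(\ell)}_{N,W}\le C_3e^{-C_4N}\qquad\text{for all integers } \ell \text{ with } 2NW(1+\epsilon)\le \ell\le N-1 .$$ **Lemma (DPSS dictionary approximation error).** (a) There is $C_3>0$ such that for every integer $L$ and every $\epsilon\in(0,L-1)$ there are $C_4>0$ and $N_1\in\mathbb Z_{\ge0}$ for which $(C_3,C_4,N_1)$ are decay constants for $(L,\epsilon)$. (b) Let $L$ be an integer, $\epsilon\in(0,L-1)$, let $(C_3,C_4,N_1)$ be any decay constants for $(L,\epsilon)$, and let $r\ge N_1$. Let $N_D=r$, $W_D=\frac1{2L}$, $k_D=\lceil 2N_DW_D(1+\epsilon)\rceil$, and let $\mathbf Q=[\mathbf s^{(0)}_{N_D,W_D}\ \cdots\ \mathbf s^{(k_D-1)}_{N_D,W_D}]\in\mathbb R^{r\times k_D}$. Let $\delta\in\mathbb R$, and let $\mathbf X_{\rm bb}\in\mathbb C^{L\times r}$ be a matrix each of whose rows, extended by zero to a sequence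 $x_i$ on $\mathbb Z$, satisfies $$\|\mathcal B_{W_D}x_i\|_2^2\ge(1-\delta)\|x_i\|_2^2,\qquad i=1,\dots,L .$$ Then $\mathbf E_{\rm a}=\mathbf X_{\rm bb}-\mathbf X_{\rm bb}\mathbf Q\mathbf Q^T$ satisfies $$\|\mathbf E_{\rm a}\|_F\le\sqrt{L\left(\delta+rC_3e^{-C_4r}\right)}\ \|\mathbf X_{\rm bb}\|_F .$$ -/

import Mathlib

noncomputable section

/-- The time-limiting operator: all entries of a two-sided sequence with index outside
`{0, 1, …, N - 1}` are set to zero. -/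
def timeLimit (N : ℕ) (x : ℤ → ℂ) : ℤ → ℂ :=
  fun k => if 0 ≤ k ∧ k < (N : ℤ) then x k else 0

/-- The discrete-time Fourier transform, as a function of the digital frequency `f`
(the frequency in units of the sampling rate), of an absolutely summable sequence.
It is applied to finitely supported sequences only. -/
def dtft (x : ℤ → ℂ) (f : ℝ) : ℂ :=
  ∑' k : ℤ, x k * Complex.exp (-(2 * Real.pi * Complex.I * f * k))

/-- The band-limiting operator: the DTFT of `x` is cut off to the digital frequencies
`|f| ≤ W` (where `0 ≤ W ≤ 1/2`) and the result is transformed back to a sequence. -/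
def bandLimit (W : ℝ) (x : ℤ → ℂ) : ℤ → ℂ :=
  fun n => ∫ f in (-W)..W, dtft x f * Complex.exp (2 * Real.pi * Complex.I * f * n)

/-- The squared `ℓ²`-norm of a square-summable two-sided sequence. -/
def seqEnergy (x : ℤ → ℂ) : ℝ := ∑' k : ℤ, ‖x k‖ ^ 2

/-- `s 0, …, s (N - 1)` are the discrete prolate spheroidal sequences with parameters `N`
and `W`, and `lam 0, …, lam (N - 1)` are their eigenvalues. (The values of `s` and `lam`
at indices `≥ N` play no role.) -/
structure IsDPSS (N : ℕ) (W : ℝ) (s : ℕ → ℤ → ℝ) (lam : ℕ → ℝ) : Prop where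
  eigen : ∀ l < N, ∀ n : ℤ,
    bandLimit W (timeLimit N (fun k => (s l k : ℂ))) n = (lam l : ℂ) * (s l n : ℂ)
  normalized : ∀ l < N, seqEnergy (timeLimit N (fun k => (s l k : ℂ))) = 1
  lt_one : ∀ l < N, lam l < 1
  pos : ∀ l < N, 0 < lam l
  strictly_decreasing : ∀ l m, l < m → m < N → lam m < lam l

/-- The matrix whose `k` columns are the first `k` DPSS vectors, i.e. the sequences
`s 0, …, s (k - 1)` restricted to the indices `0, …, N - 1`. -/
def dpssMatrix (N k : ℕ) (s : ℕ → ℤ → ℝ) : Matrix (Fin N) (Fin k) ℝ :=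
  Matrix.of fun n l => s l ((n : ℕ) : ℤ)

/-- The two-sided sequence that vanishes outside `{0, …, N - 1}` and is given there by
the vector `v`. -/
def zeroExtend {N : ℕ} (v : Fin N → ℂ) : ℤ → ℂ :=
  fun k => if h : 0 ≤ k ∧ k < (N : ℤ) then v ⟨k.toNat, by omega⟩ else 0

/-- `C₃`, `C₄`, `N₁` are constants for the exponential decay of the DPSS eigenvalues beyond
index `2NW(1 + ε)`: for all `N ≥ N₁` and all `l ≥ 2NW(1 + ε)`, the `l`-th DPSS eigenvalue
is at most `C₃ e^{-C₄ N}`. -/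
def DPSSEigenvalueDecay (W ε C₃ C₄ : ℝ) (N₁ : ℕ) : Prop :=
  ∀ N : ℕ, N₁ ≤ N → ∀ (s : ℕ → ℤ → ℝ) (lam : ℕ → ℝ), IsDPSS N W s lam →
    ∀ l : ℕ, l < N → 2 * (N : ℝ) * W * (1 + ε) ≤ (l : ℝ) →
      lam l ≤ C₃ * Real.exp (-C₄ * N)

/-- The number `2NW(1 + ε)` of DPSS vectors in the dictionary, rounded up to an integer. -/
def dictSize (N : ℕ) (W ε : ℝ) : ℕ := ⌈2 * (N : ℝ) * W * (1 + ε)⌉₊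

/-- The approximation error `X - X Q Qᵀ`. -/
def approxError {L r k : ℕ} (X : Matrix (Fin L) (Fin r) ℂ) (Q : Matrix (Fin r) (Fin k) ℝ) :
    Matrix (Fin L) (Fin r) ℂ :=
  X - X * Q.map Complex.ofReal * (Q.map Complex.ofReal).transpose

end

attribute [local instance] Matrix.frobeniusNormedAddCommGroup

/-!
Both parts rest on one fact: the DPSS vectors `v_0, …, v_{N-1}` form an orthonormal basis of
`ℂ ^ N` in which the band energy is diagonal. If `X` is the transform of `x`, then
`∫_{-W}^{W} |X|² = ∑ λ_m |⟨v_m, x⟩|²` (`IsDPSS.integral_normSq_vecDtft`).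

*Eigenvalue decay.* By the min-max principle, `λ_l` is at most the band energy of some unit vector
`x` whose transform `X` vanishes at `l` prescribed frequencies (`IsDPSS.exists_vecDtft_eq_zero`).
Put `P = N + M` with `M` about `η N`, and prescribe zeros at those of the frequencies `j / P` that lie
in the band widened by the factor `1 + η`; their number is about `2 P W (1 + η)`, which is below
`2 N W (1 + ε)` when `η` is small compared with `ε`. For `y` in the band, multiply `X` by a
trigonometric polynomial of degree `M` with absolute value `|cos (π (f - y))| ^ M`. The product has
`P` coefficients, so it is determined by its samples at the `j / P`. They vanish near the
band, and elsewhere they are as small as `cos (π η W) ^ M`. Hence `X(y)` is exponentially small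
(`norm_vecDtft_le_of_samples`), and so is `λ_l` (`IsDPSS.eigenvalue_le`, `exists_decay`).

*Approximation error.* The energy of the band-limited sequence is at most the band energy, by
Bessel's inequality (`seqEnergy_bandLimit_le`). For a row `x` with DPSS coefficients `c_m`, the
hypothesis thus gives `∑ (1 - λ_m) |c_m|² ≤ δ ‖x‖²`. Since every term is nonnegative, the tail
`∑_{m ≥ k} |c_m|²`, which is the squared error of the row, is at most `(δ + λ_k) ‖x‖²`
(`IsDPSS.tail_energy_le`). Summing over the rows gives the bound (`norm_approxError_le`), even
without the factors `L` and `r`.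
-/

/-! ### Polynomials at roots of unity -/

open Polynomial in
/-- The inverse discrete Fourier transform recovers the coefficients of a polynomial of degree less
than `P` from its values at the `P`-th roots of unity. -/
theorem coeff_eq_sum_eval_primitiveRoot {P : ℕ} {ζ : ℂ} (hζ : IsPrimitiveRoot ζ P) (p : ℂ[X])
    (hp : p.degree < P) {k : ℕ} (hk : k < P) :
    (P : ℂ) * p.coeff k = ∑ j ∈ Finset.range P, p.eval (ζ ^ j) * (ζ ^ j)⁻¹ ^ k := by
  have hP : P ≠ 0 := by omega
  have hζ0 : ζ ≠ 0 := hζ.ne_zero hP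
  have hnd : p.natDegree < P := by
    rcases eq_or_ne p 0 with rfl | h
    · simpa using Nat.pos_of_ne_zero hP
    · exact (natDegree_lt_iff_degree_lt h).2 hp
  have key : ∀ i ∈ Finset.range P,
      ∑ j ∈ Finset.range P, p.coeff i * (ζ ^ j) ^ i * (ζ ^ j)⁻¹ ^ k =
        if i = k then (P : ℂ) * p.coeff k else 0 := by
    intro i hi
    rw [Finset.mem_range] at hi
    have h1 : ∀ j, p.coeff i * (ζ ^ j) ^ i * (ζ ^ j)⁻¹ ^ k
        = p.coeff i * (ζ ^ i * (ζ ^ k)⁻¹) ^ j := by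
      intro j
      rw [mul_pow, inv_pow, inv_pow, ← pow_mul, ← pow_mul, ← pow_mul, ← pow_mul,
        mul_comm j i, mul_comm j k, mul_assoc]
    simp_rw [h1, ← Finset.mul_sum]
    split_ifs with hik
    · subst hik
      rw [mul_inv_cancel₀ (pow_ne_zero _ hζ0)]
      simp [mul_comm]
    · have hne : ζ ^ i * (ζ ^ k)⁻¹ ≠ 1 := by
        intro h
        apply hik
        apply hζ.pow_inj hi hk
        exact (mul_inv_eq_one₀ (pow_ne_zero _ hζ0)).1 h
      have hpow : (ζ ^ i * (ζ ^ k)⁻¹) ^ P = 1 := by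
        rw [mul_pow, inv_pow, ← pow_mul, ← pow_mul, mul_comm i, mul_comm k, pow_mul, pow_mul,
          hζ.pow_eq_one]
        simp
      rw [geom_sum_eq hne, hpow]
      simp
  simp_rw [eval_eq_sum_range' hnd, Finset.sum_mul]
  rw [Finset.sum_comm, Finset.sum_congr rfl key]
  simp [hk]

open Polynomial in
/-- A polynomial of degree less than `P` that is bounded by `B` at the `P`-th roots of unity has
all its coefficients bounded by `B`, hence is bounded by `P * B` on the unit circle. -/
theorem norm_eval_le_of_norm_eval_primitiveRoot_le {P : ℕ} {ζ : ℂ} (hζ : IsPrimitiveRoot ζ P)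
    (hP : P ≠ 0) (p : ℂ[X]) (hp : p.degree < P) {B : ℝ}
    (hB : ∀ j < P, ‖p.eval (ζ ^ j)‖ ≤ B) {w : ℂ} (hw : ‖w‖ = 1) :
    ‖p.eval w‖ ≤ P * B := by
  have hP' : (0 : ℝ) < P := by exact_mod_cast Nat.pos_of_ne_zero hP
  have hnd : p.natDegree < P := by
    rcases eq_or_ne p 0 with rfl | h
    · simpa using Nat.pos_of_ne_zero hP
    · exact (natDegree_lt_iff_degree_lt h).2 hp
  have hc : ∀ k < P, ‖p.coeff k‖ ≤ B := by
    intro k hk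
    have h := congrArg norm (coeff_eq_sum_eval_primitiveRoot hζ p hp hk)
    rw [norm_mul, Complex.norm_natCast] at h
    have h2 : (P : ℝ) * ‖p.coeff k‖ ≤ P * B := by
      rw [h]
      refine (norm_sum_le _ _).trans ?_
      refine (Finset.sum_le_card_nsmul _ _ B ?_).trans (by simp)
      intro j hj
      simpa [hζ.norm'_eq_one hP] using hB j (Finset.mem_range.1 hj)
    exact le_of_mul_le_mul_left h2 hP'
  rw [eval_eq_sum_range' hnd]
  refine (norm_sum_le _ _).trans ?_
  refine (Finset.sum_le_card_nsmul _ _ B ?_).trans (by simp)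
  intro j hj
  simpa [hw] using hc j (Finset.mem_range.1 hj)

/-! ### Localized interpolation of the discrete-time Fourier transform -/

/-- The discrete-time Fourier transform `∑ n, x n * exp (-2πi f n)` of a vector with
indices `0, …, N - 1`, at the digital frequency `f`. -/
noncomputable def vecDtft {N : ℕ} (x : Fin N → ℂ) (f : ℝ) : ℂ :=
  ∑ n : Fin N, x n * Complex.exp (-(2 * Real.pi * Complex.I * f * (n : ℕ)))

theorem norm_vecDtft_le {N : ℕ} (x : Fin N → ℂ) (f : ℝ) : ‖vecDtft x f‖ ≤ ∑ n, ‖x n‖ := by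
  refine (norm_sum_le _ _).trans (Finset.sum_le_sum fun n _ => ?_)
  rw [norm_mul]
  have : -(2 * Real.pi * Complex.I * f * (n : ℕ)) =
      ((-(2 * Real.pi * f * n) : ℝ) : ℂ) * Complex.I := by
    push_cast; ring
  rw [this, Complex.norm_exp_ofReal_mul_I, mul_one]

theorem norm_one_add_exp_div_two (θ : ℝ) :
    ‖(1 + Complex.exp (2 * θ * Complex.I)) / 2‖ = |Real.cos θ| := by
  have h : (1 + Complex.exp (2 * θ * Complex.I)) / 2
      = Complex.exp (θ * Complex.I) * (Real.cos θ : ℝ) := by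
    rw [Complex.ofReal_cos, Complex.cos,
      show (2 * θ * Complex.I : ℂ) = θ * Complex.I + θ * Complex.I by ring,
      Complex.exp_add, ← mul_div_assoc, mul_add, ← Complex.exp_add (_) (-_ * _)]
    simp [add_comm]
  rw [h, norm_mul, Complex.norm_exp_ofReal_mul_I, one_mul, Complex.norm_real, Real.norm_eq_abs]

open Polynomial in
/-- Localized interpolation: oversampling a transform of length `N` at `N + M` equispaced
frequencies leaves room for a factor of degree `M` that equals `1` at `y` and is at most `q ^ M` in
absolute value at each sample far from `y`. If the samples near `y` vanish, the value at `y` is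
therefore of size `q ^ M`. -/
theorem norm_vecDtft_le_of_samples {N M : ℕ} (hN : 0 < N) (x : Fin N → ℂ) (y : ℝ) {q : ℝ}
    (hq : 0 ≤ q)
    (h : ∀ j < N + M, vecDtft x (j / (N + M : ℕ)) = 0 ∨
      |Real.cos (Real.pi * (j / (N + M : ℕ) - y))| ≤ q) :
    ‖vecDtft x y‖ ≤ (N + M : ℕ) * (q ^ M * ∑ n, ‖x n‖) := by
  set P := N + M with hPdef
  have hP : P ≠ 0 := by omega
  have hζ : IsPrimitiveRoot (Complex.exp (2 * Real.pi * Complex.I / P))⁻¹ P :=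
    (Complex.isPrimitiveRoot_exp P hP).inv
  set ζ := (Complex.exp (2 * Real.pi * Complex.I / P))⁻¹ with hζdef
  let w : ℝ → ℂ := fun f => Complex.exp (-(2 * Real.pi * Complex.I * f))
  have hw : ∀ f, ‖w f‖ = 1 := by
    intro f
    have : -(2 * Real.pi * Complex.I * f) = ((-(2 * Real.pi * f) : ℝ) : ℂ) * Complex.I := by
      push_cast; ring
    simp only [w]
    rw [this, Complex.norm_exp_ofReal_mul_I]
  let p₀ : ℂ[X] := ∑ n : Fin N, C (x n) * X ^ (n : ℕ)
  have hp₀ : ∀ f, p₀.eval (w f) = vecDtft x f := by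
    intro f
    simp only [p₀, vecDtft, eval_finsetSum, eval_mul, eval_C, eval_pow, eval_X, w]
    refine Finset.sum_congr rfl fun n _ => ?_
    rw [← Complex.exp_nat_mul]
    congr 2; ring
  -- at `w f` this factor has absolute value `|cos (π (y - f))|`, and it is `1` at `w y`
  let g : ℂ[X] := C (w (-y) / 2) * X + C (1 / 2)
  have hg : ∀ f, g.eval (w f) =
      (1 + Complex.exp (2 * ((Real.pi * (y - f) : ℝ) : ℂ) * Complex.I)) / 2 := by
    intro f
    simp only [g, eval_add, eval_mul, eval_C, eval_X, w]
    rw [div_mul_eq_mul_div, ← Complex.exp_add, ← add_div, add_comm]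
    congr 3
    push_cast; ring
  let p := p₀ * g ^ M
  have hdeg : p.degree < P := by
    have h1 : p₀.degree < N := by
      refine lt_of_le_of_lt (degree_sum_le _ _) ?_
      rw [Finset.sup_lt_iff (by exact WithBot.bot_lt_coe N)]
      intro n _
      refine lt_of_le_of_lt (degree_C_mul_X_pow_le _ _) ?_
      exact_mod_cast n.2
    have h2 : (g ^ M).degree ≤ M := by
      refine (degree_pow_le _ _).trans ?_
      have : g.degree ≤ 1 := degree_linear_le
      calc M • g.degree ≤ M • (1 : WithBot ℕ) := nsmul_le_nsmul_right this M
        _ = M := by simp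
    have h3 : p.natDegree < P := by
      refine lt_of_le_of_lt natDegree_mul_le ?_
      have h1' : p₀.natDegree < N := by
        rcases eq_or_ne p₀ 0 with h0 | h0
        · simpa [h0] using hN
        · exact (natDegree_lt_iff_degree_lt h0).2 h1
      have h2' : (g ^ M).natDegree ≤ M := natDegree_le_of_degree_le h2
      omega
    exact lt_of_le_of_lt degree_le_natDegree (by exact_mod_cast h3)
  have hval : vecDtft x y = p.eval (w y) := by
    simp only [p, eval_mul, eval_pow, hp₀, hg]
    simp
  have hζw : ∀ j : ℕ, ζ ^ j = w (j / P) := by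
    intro j
    simp only [w, hζdef]
    rw [inv_pow, ← Complex.exp_nat_mul, ← Complex.exp_neg]
    congr 1; push_cast; ring
  rw [hval]
  refine norm_eval_le_of_norm_eval_primitiveRoot_le hζ hP p hdeg ?_ (hw y)
  intro j hj
  rw [hζw]
  simp only [p, eval_mul, eval_pow, hp₀, hg, norm_mul, norm_pow, norm_one_add_exp_div_two]
  have hS : 0 ≤ ∑ n, ‖x n‖ := Finset.sum_nonneg fun n _ => norm_nonneg _
  rcases h j hj with h0 | h0
  · rw [h0]; simp; positivity
  · rw [mul_comm]
    rw [show Real.pi * (y - j / P) = -(Real.pi * (j / P - y)) by ring, Real.cos_neg]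
    exact mul_le_mul (pow_le_pow_left₀ (abs_nonneg _) h0 M) (norm_vecDtft_le x _)
      (norm_nonneg _) (by positivity)

/-! ### The band energy form and Bessel's inequality -/

open scoped ComplexConjugate

/-- The sesquilinear form `∫_{-W}^{W} X(f) * conj Y(f) df` of the transforms `X`, `Y` of two vectors,
i.e. the form of the time- and band-limiting operator on `ℂ ^ N`. -/
noncomputable def bandForm {N : ℕ} (W : ℝ) (x y : Fin N → ℂ) : ℂ :=
  ∫ f in (-W)..W, vecDtft x f * conj (vecDtft y f)

@[fun_prop]
theorem continuous_vecDtft {N : ℕ} (x : Fin N → ℂ) : Continuous (vecDtft x) := by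
  unfold vecDtft; fun_prop

theorem natCast_fin_injective (N : ℕ) : Function.Injective fun n : Fin N => ((n : ℕ) : ℤ) :=
  fun _ _ hab => Fin.ext (Int.ofNat_injective hab)

theorem tsum_int_eq_sum_fin {A : Type*} [AddCommMonoid A] [TopologicalSpace A] (N : ℕ) (F : ℤ → A)
    (h : ∀ k, ¬ (0 ≤ k ∧ k < (N : ℤ)) → F k = 0) : ∑' k, F k = ∑ n : Fin N, F (n : ℕ) := by
  rw [tsum_eq_sum (s := Finset.univ.image fun n : Fin N => ((n : ℕ) : ℤ))]
  · rw [Finset.sum_image (natCast_fin_injective N).injOn]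
  · intro k hk
    apply h
    rintro ⟨h0, h1⟩
    apply hk
    rw [Finset.mem_image]
    exact ⟨⟨k.toNat, by omega⟩, Finset.mem_univ _, by simp [h0]⟩

theorem zeroExtend_natCast {N : ℕ} (x : Fin N → ℂ) (n : Fin N) :
    zeroExtend x ((n : ℕ) : ℤ) = x n := by
  simp [zeroExtend]

theorem zeroExtend_of_not {N : ℕ} (x : Fin N → ℂ) {k : ℤ} (h : ¬ (0 ≤ k ∧ k < (N : ℤ))) :
    zeroExtend x k = 0 := by
  simp only [zeroExtend, dif_neg h]

theorem timeLimit_eq_zeroExtend (N : ℕ) (y : ℤ → ℂ) :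
    timeLimit N y = zeroExtend (fun n : Fin N => y (n : ℕ)) := by
  ext k
  unfold timeLimit zeroExtend
  split_ifs with h
  · simp [h.1]
  · rfl

theorem dtft_zeroExtend {N : ℕ} (x : Fin N → ℂ) : dtft (zeroExtend x) = vecDtft x := by
  ext f
  unfold dtft vecDtft
  rw [tsum_int_eq_sum_fin N]
  · simp [zeroExtend_natCast]
  · intro k hk; rw [zeroExtend_of_not x hk, zero_mul]

theorem seqEnergy_zeroExtend {N : ℕ} (x : Fin N → ℂ) :
    seqEnergy (zeroExtend x) = ∑ n, ‖x n‖ ^ 2 := by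
  unfold seqEnergy
  rw [tsum_int_eq_sum_fin N]
  · simp [zeroExtend_natCast]
  · intro k hk; rw [zeroExtend_of_not x hk]; simp

theorem conj_exp_neg_two_pi (f : ℝ) (n : ℤ) :
    conj (Complex.exp (-(2 * Real.pi * Complex.I * f * n)))
      = Complex.exp (2 * Real.pi * Complex.I * f * n) := by
  rw [← Complex.exp_conj]
  simp [Complex.conj_ofNat]

theorem sum_bandLimit_mul_conj {N : ℕ} (W : ℝ) (x : Fin N → ℂ) (F : Finset ℤ) (y : ℤ → ℂ) :
    ∑ n ∈ F, bandLimit W (zeroExtend x) n * conj (y n) = ∫ f in (-W)..W, vecDtft x f *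
      conj (∑ n ∈ F, y n * Complex.exp (-(2 * Real.pi * Complex.I * f * n))) := by
  simp_rw [map_sum, Finset.mul_sum]
  rw [intervalIntegral.integral_finsetSum]
  · refine Finset.sum_congr rfl fun n _ => ?_
    rw [bandLimit, dtft_zeroExtend, ← intervalIntegral.integral_mul_const]
    congr 1; ext f
    rw [map_mul, conj_exp_neg_two_pi]; ring
  · intro n _
    apply Continuous.intervalIntegrable
    simp_rw [map_mul, conj_exp_neg_two_pi]
    fun_prop

theorem sum_fin_bandLimit_mul_conj {N : ℕ} (W : ℝ) (x y : Fin N → ℂ) :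
    ∑ n : Fin N, bandLimit W (zeroExtend x) (n : ℕ) * conj (y n) = bandForm W x y := by
  have h := sum_bandLimit_mul_conj W x (Finset.univ.image fun n : Fin N => ((n : ℕ) : ℤ))
    (zeroExtend y)
  simp_rw [Finset.sum_image (natCast_fin_injective N).injOn, zeroExtend_natCast] at h
  simpa [bandForm, vecDtft] using h

theorem integral_exp_two_pi (n : ℤ) :
    ∫ f in (-(1 / 2) : ℝ)..(1 / 2), Complex.exp (2 * Real.pi * Complex.I * f * n)
      = if n = 0 then 1 else 0 := by
  split_ifs with h
  · subst h; norm_num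
  · have hc : (2 * Real.pi * Complex.I * n : ℂ) ≠ 0 := by
      simp [Real.pi_ne_zero, h]
    have h1 : ∀ f : ℝ, (2 * Real.pi * Complex.I * f * n : ℂ) =
        (2 * Real.pi * Complex.I * n) * f := by
      intro f; ring
    simp_rw [h1]
    rw [integral_exp_mul_complex hc, div_eq_zero_iff]
    left
    rw [sub_eq_zero, Complex.exp_eq_exp_iff_exists_int]
    exact ⟨n, by push_cast; ring⟩

/-- Parseval's identity for trigonometric polynomials. -/
theorem integral_normSq_sum_exp (F : Finset ℤ) (b : ℤ → ℂ) :
    ∫ f in (-(1 / 2) : ℝ)..(1 / 2),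
      ‖∑ n ∈ F, b n * Complex.exp (-(2 * Real.pi * Complex.I * f * n))‖ ^ 2
      = ∑ n ∈ F, ‖b n‖ ^ 2 := by
  apply Complex.ofReal_injective
  rw [← intervalIntegral.integral_ofReal]
  have h : ∀ f : ℝ, ((‖∑ n ∈ F, b n * Complex.exp (-(2 * Real.pi * Complex.I * f * n))‖ ^ 2 : ℝ) : ℂ)
      = ∑ n ∈ F, ∑ m ∈ F, b n * conj (b m) *
          Complex.exp (2 * Real.pi * Complex.I * f * (m - n : ℤ)) := by
    intro f
    push_cast
    rw [← Complex.mul_conj', map_sum, Finset.sum_mul_sum]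
    refine Finset.sum_congr rfl fun n _ => Finset.sum_congr rfl fun m _ => ?_
    rw [map_mul, conj_exp_neg_two_pi, mul_mul_mul_comm, ← Complex.exp_add]
    congr 2; ring
  simp_rw [h]
  rw [intervalIntegral.integral_finsetSum]
  · rw [Complex.ofReal_sum]
    refine Finset.sum_congr rfl fun n hn => ?_
    rw [intervalIntegral.integral_finsetSum]
    · simp_rw [intervalIntegral.integral_const_mul, integral_exp_two_pi, sub_eq_zero]
      simp [hn, Complex.mul_conj']
    · intro m _
      apply Continuous.intervalIntegrable
      fun_prop
  · intro m _
    apply Continuous.intervalIntegrable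
    fun_prop

theorem bandForm_self {N : ℕ} (W : ℝ) (x : Fin N → ℂ) :
    bandForm W x x = ((∫ f in (-W)..W, ‖vecDtft x f‖ ^ 2 : ℝ) : ℂ) := by
  rw [bandForm, ← intervalIntegral.integral_ofReal]
  congr 1; ext f
  rw [Complex.mul_conj']; push_cast; rfl

/-- Bessel's inequality for the band-limited sequence, whose entries are the Fourier coefficients
of the transform cut off to `[-W, W]`. -/
theorem seqEnergy_bandLimit_le {N : ℕ} {W : ℝ} (hW : 0 ≤ W) (hW' : W ≤ 1 / 2) (x : Fin N → ℂ) :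
    seqEnergy (bandLimit W (zeroExtend x)) ≤ ∫ f in (-W)..W, ‖vecDtft x f‖ ^ 2 := by
  have hWW : -W ≤ W := by linarith
  refine tsum_le_of_sum_le' (intervalIntegral.integral_nonneg hWW fun _ _ => by positivity) ?_
  -- `∑ |b n|²` is the integral of `X * conj S` over the band, where `S` has coefficients `b n`; this
  -- is at most half the band energy of `X` plus half the full energy of `S`, which is `∑ |b n|²`
  intro F
  set b := bandLimit W (zeroExtend x)
  set S : ℝ → ℂ := fun f => ∑ n ∈ F, b n * Complex.exp (-(2 * Real.pi * Complex.I * f * n)) with hS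
  have hSc : Continuous S := by simp only [hS]; fun_prop
  have h1 : ((∑ n ∈ F, ‖b n‖ ^ 2 : ℝ) : ℂ) = ∫ f in (-W)..W, vecDtft x f * conj (S f) := by
    rw [← sum_bandLimit_mul_conj]
    push_cast
    exact Finset.sum_congr rfl fun n _ => (Complex.mul_conj' _).symm
  have h2 : ∑ n ∈ F, ‖b n‖ ^ 2 ≤ ∫ f in (-W)..W, (‖vecDtft x f‖ ^ 2 + ‖S f‖ ^ 2) / 2 := by
    have h0 : 0 ≤ ∑ n ∈ F, ‖b n‖ ^ 2 := Finset.sum_nonneg fun _ _ => by positivity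
    calc ∑ n ∈ F, ‖b n‖ ^ 2 = ‖((∑ n ∈ F, ‖b n‖ ^ 2 : ℝ) : ℂ)‖ := by
          rw [Complex.norm_real, Real.norm_of_nonneg h0]
      _ = ‖∫ f in (-W)..W, vecDtft x f * conj (S f)‖ := by rw [h1]
      _ ≤ _ := by
        refine intervalIntegral.norm_integral_le_of_norm_le hWW ?_ ?_
        · refine Filter.Eventually.of_forall fun f _ => ?_
          rw [norm_mul, RCLike.norm_conj]
          nlinarith [sq_nonneg (‖vecDtft x f‖ - ‖S f‖)]
        · apply Continuous.intervalIntegrable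
          fun_prop
  have h3 : ∫ f in (-W)..W, ‖S f‖ ^ 2 ≤ ∑ n ∈ F, ‖b n‖ ^ 2 := by
    rw [← integral_normSq_sum_exp]
    apply intervalIntegral.integral_mono_interval (by linarith) hWW hW'
    · exact Filter.Eventually.of_forall fun f => by positivity
    · apply Continuous.intervalIntegrable
      fun_prop
  rw [intervalIntegral.integral_div, intervalIntegral.integral_add] at h2
  · linarith
  all_goals
    apply Continuous.intervalIntegrable
    fun_prop

/-! ### The DPSS vectors as an orthonormal eigenbasis -/

theorem vecDtft_sum_smul {N : ℕ} {ι : Type*} (s : Finset ι) (c : ι → ℂ) (v : ι → Fin N → ℂ)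
    (f : ℝ) : vecDtft (fun n => ∑ i ∈ s, c i * v i n) f = ∑ i ∈ s, c i * vecDtft (v i) f := by
  unfold vecDtft
  simp_rw [Finset.sum_mul, Finset.mul_sum, mul_assoc]
  exact Finset.sum_comm

theorem bandForm_sum_left {N : ℕ} {ι : Type*} (W : ℝ) (s : Finset ι) (c : ι → ℂ)
    (v : ι → Fin N → ℂ) (y : Fin N → ℂ) :
    bandForm W (fun n => ∑ i ∈ s, c i * v i n) y = ∑ i ∈ s, c i * bandForm W (v i) y := by
  unfold bandForm
  simp_rw [vecDtft_sum_smul, Finset.sum_mul]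
  rw [intervalIntegral.integral_finsetSum]
  · simp_rw [mul_assoc, intervalIntegral.integral_const_mul]
  · intro i _
    apply Continuous.intervalIntegrable
    have := fun i => continuous_vecDtft (v i)
    fun_prop

theorem conj_bandForm {N : ℕ} (W : ℝ) (x y : Fin N → ℂ) :
    conj (bandForm W x y) = bandForm W y x := by
  unfold bandForm
  rw [← intervalIntegral.intervalIntegral_conj]
  congr 1; ext f
  rw [map_mul, Complex.conj_conj, mul_comm]

/-- The `l`-th DPSS vector, as a vector of `ℂ ^ N`. -/
noncomputable def dpssVec (N : ℕ) (s : ℕ → ℤ → ℝ) (l : Fin N) : EuclideanSpace ℂ (Fin N) :=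
  WithLp.toLp 2 fun n : Fin N => (s l (n : ℕ) : ℂ)

theorem IsDPSS.bandForm_dpssVec {N : ℕ} {W : ℝ} {s : ℕ → ℤ → ℝ} {lam : ℕ → ℝ}
    (h : IsDPSS N W s lam) (l : Fin N) (y : EuclideanSpace ℂ (Fin N)) :
    bandForm W (dpssVec N s l) y = lam l * inner ℂ y (dpssVec N s l) := by
  rw [← sum_fin_bandLimit_mul_conj]
  have h1 := h.eigen l l.2
  rw [timeLimit_eq_zeroExtend] at h1
  simp only [PiLp.inner_apply, RCLike.inner_apply, Finset.mul_sum]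
  refine Finset.sum_congr rfl fun n _ => ?_
  rw [← mul_assoc]
  congr 1
  exact h1 _

/-- The form is Hermitian and the eigenvalues are distinct, so that the eigenvectors are
orthogonal. -/
theorem IsDPSS.orthonormal {N : ℕ} {W : ℝ} {s : ℕ → ℤ → ℝ} {lam : ℕ → ℝ}
    (h : IsDPSS N W s lam) : Orthonormal ℂ (dpssVec N s) := by
  refine ⟨fun l => ?_, fun l m hlm => ?_⟩
  · have h1 := h.normalized l l.2
    rw [timeLimit_eq_zeroExtend, seqEnergy_zeroExtend] at h1
    rw [EuclideanSpace.norm_eq, Real.sqrt_eq_one]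
    exact h1
  · have h1 := conj_bandForm W (dpssVec N s l) (dpssVec N s m)
    rw [h.bandForm_dpssVec, h.bandForm_dpssVec, map_mul, inner_conj_symm, Complex.conj_ofReal] at h1
    have hne : lam l ≠ lam m := by
      rcases lt_or_gt_of_ne hlm with hlt | hlt
      · exact (h.strictly_decreasing l m hlt m.2).ne'
      · exact (h.strictly_decreasing m l hlt l.2).ne
    have h2 : ((lam l : ℂ) - lam m) * inner ℂ (dpssVec N s l) (dpssVec N s m) = 0 := by
      rw [sub_mul, h1, sub_self]
    exact (mul_eq_zero.1 h2).resolve_left (sub_ne_zero.2 (by exact_mod_cast hne))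

/-- The DPSS vectors, as an orthonormal basis of `ℂ ^ N`. -/
noncomputable def IsDPSS.basis {N : ℕ} {W : ℝ} {s : ℕ → ℤ → ℝ} {lam : ℕ → ℝ}
    (h : IsDPSS N W s lam) : OrthonormalBasis (Fin N) ℂ (EuclideanSpace ℂ (Fin N)) :=
  OrthonormalBasis.mk h.orthonormal
    (h.orthonormal.linearIndependent.span_eq_top_of_card_eq_finrank' (by simp)).ge

theorem IsDPSS.basis_apply {N : ℕ} {W : ℝ} {s : ℕ → ℤ → ℝ} {lam : ℕ → ℝ}
    (h : IsDPSS N W s lam) (l : Fin N) : h.basis l = dpssVec N s l := by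
  simp [IsDPSS.basis]

theorem IsDPSS.sum_inner_mul_dpssVec {N : ℕ} {W : ℝ} {s : ℕ → ℤ → ℝ} {lam : ℕ → ℝ}
    (h : IsDPSS N W s lam) (x : EuclideanSpace ℂ (Fin N)) :
    (fun n => ∑ l, inner ℂ (dpssVec N s l) x * dpssVec N s l n) = x := by
  conv_rhs => rw [← h.basis.sum_repr' x]
  ext n
  simp [h.basis_apply]

/-- The quadratic form of the time- and band-limiting operator is diagonal in the DPSS basis. -/
theorem IsDPSS.integral_normSq_vecDtft {N : ℕ} {W : ℝ} {s : ℕ → ℤ → ℝ} {lam : ℕ → ℝ}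
    (h : IsDPSS N W s lam) (x : EuclideanSpace ℂ (Fin N)) :
    ∫ f in (-W)..W, ‖vecDtft x f‖ ^ 2 = ∑ l : Fin N, lam l * ‖inner ℂ (dpssVec N s l) x‖ ^ 2 := by
  apply Complex.ofReal_injective
  rw [← bandForm_self]
  conv_lhs => rw [← h.sum_inner_mul_dpssVec x, bandForm_sum_left, h.sum_inner_mul_dpssVec x]
  push_cast
  refine Finset.sum_congr rfl fun l _ => ?_
  rw [h.bandForm_dpssVec, ← inner_conj_symm x, mul_left_comm, Complex.mul_conj']

theorem IsDPSS.sum_sq_norm_inner {N : ℕ} {W : ℝ} {s : ℕ → ℤ → ℝ} {lam : ℕ → ℝ}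
    (h : IsDPSS N W s lam) (x : EuclideanSpace ℂ (Fin N)) :
    ∑ l, ‖inner ℂ (dpssVec N s l) x‖ ^ 2 = ∑ n, ‖x n‖ ^ 2 := by
  rw [← EuclideanSpace.norm_sq_eq, ← h.basis.sum_sq_norm_inner_right x]
  simp [h.basis_apply]

/-! ### Exponential decay of the eigenvalues -/

/-- The min-max bound: an eigenvalue with index `l` is bounded by the band energy of some vector of
unit energy whose transform vanishes at `l` prescribed frequencies. -/
theorem IsDPSS.exists_vecDtft_eq_zero {N d : ℕ} {W : ℝ} {s : ℕ → ℤ → ℝ} {lam : ℕ → ℝ}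
    (h : IsDPSS N W s lam) {l : ℕ} (hl : l < N) (hd : d ≤ l) (t : Fin d → ℝ) :
    ∃ x : EuclideanSpace ℂ (Fin N), 0 < ∑ n, ‖x n‖ ^ 2 ∧ (∀ j, vecDtft x (t j) = 0) ∧
      lam l * ∑ n, ‖x n‖ ^ 2 ≤ ∫ f in (-W)..W, ‖vecDtft x f‖ ^ 2 := by
  -- the coefficients beyond `l` are required to vanish too, which leaves a nonzero solution
  let T : EuclideanSpace ℂ (Fin N) →ₗ[ℂ] (Fin d ⊕ {m : Fin N // ⟨l, hl⟩ < m} → ℂ) :=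
    { toFun := fun x => Sum.elim (fun j => vecDtft x (t j))
        (fun m => inner ℂ (dpssVec N s m) x)
      map_add' := fun x y => by
        ext (j | m)
        · simp [vecDtft, add_mul, Finset.sum_add_distrib]
        · simp
      map_smul' := fun c x => by
        ext (j | m)
        · simp [vecDtft, mul_assoc, Finset.mul_sum]
        · simp }
  have hker : LinearMap.ker T ≠ ⊥ := by
    apply LinearMap.ker_ne_bot_of_finrank_lt
    have : Fintype.card {m : Fin N // ⟨l, hl⟩ < m} = N - 1 - l := by
      rw [Fintype.card_subtype]
      simp [Finset.filter_lt_eq_Ioi]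
    rw [Module.finrank_fintype_fun_eq_card, Fintype.card_sum, this]
    simp only [Fintype.card_fin, finrank_euclideanSpace]
    omega
  obtain ⟨x, hx, hx0⟩ := Submodule.exists_mem_ne_zero_of_ne_bot hker
  rw [LinearMap.mem_ker] at hx
  refine ⟨x, ?_, fun j => congrFun hx (Sum.inl j), ?_⟩
  · rw [← EuclideanSpace.norm_sq_eq]
    have := norm_pos_iff.2 hx0
    positivity
  · rw [h.integral_normSq_vecDtft, ← h.sum_sq_norm_inner, Finset.mul_sum]
    refine Finset.sum_le_sum fun m _ => ?_
    rcases le_or_gt m ⟨l, hl⟩ with hm | hm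
    · refine mul_le_mul_of_nonneg_right ?_ (by positivity)
      rcases hm.eq_or_lt with rfl | hm
      · exact le_rfl
      · exact (h.strictly_decreasing m l hm hl).le
    · have : inner ℂ (dpssVec N s m) x = 0 := congrFun hx (Sum.inr ⟨m, hm⟩)
      simp [this]

theorem abs_cos_le_of_mem {a t : ℝ} (ha : 0 ≤ a) (h1 : a ≤ t) (h2 : t ≤ 1 - a) :
    |Real.cos (Real.pi * t)| ≤ Real.cos (Real.pi * a) := by
  have hpi := Real.pi_pos
  rw [abs_le]
  constructor
  · rw [← Real.cos_pi_sub]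
    apply Real.cos_le_cos_of_nonneg_of_le_pi <;> nlinarith
  · apply Real.cos_le_cos_of_nonneg_of_le_pi <;> nlinarith

theorem vecDtft_add_int {N : ℕ} (x : Fin N → ℂ) (f : ℝ) (k : ℤ) :
    vecDtft x (f + k) = vecDtft x f := by
  unfold vecDtft
  refine Finset.sum_congr rfl fun n _ => ?_
  congr 1
  rw [Complex.exp_eq_exp_iff_exists_int]
  exact ⟨-(k * n), by push_cast; ring⟩

/-- Explicit eigenvalue bound: with `N + M` equispaced frequencies, those within `J` steps of `0`
serve as the prescribed zeros, and all the others stay at distance `a` from the band. -/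
theorem IsDPSS.eigenvalue_le {N M J : ℕ} {W a : ℝ} {s : ℕ → ℤ → ℝ} {lam : ℕ → ℝ}
    (h : IsDPSS N W s lam) (hW : 0 ≤ W) (hW' : W ≤ 1 / 2) (ha : 0 ≤ a) (ha' : a ≤ 1 / 2)
    (hJ : (N + M : ℕ) * (W + a) ≤ J + 1) {l : ℕ} (hl : l < N) (hJl : 2 * J + 1 ≤ l) :
    lam l ≤ N * ((N + M : ℕ) * Real.cos (Real.pi * a) ^ M) ^ 2 := by
  set P := N + M with hP
  set q := Real.cos (Real.pi * a)
  have hPpos : (0 : ℝ) < P := by exact_mod_cast (by omega : 0 < P)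
  have hq : 0 ≤ q := by
    apply Real.cos_nonneg_of_neg_pi_div_two_le_of_le <;> nlinarith [Real.pi_pos]
  obtain ⟨x, hx0, hxt, hxl⟩ := h.exists_vecDtft_eq_zero hl hJl
    (fun j : Fin (2 * J + 1) => (((j : ℕ) - J : ℝ)) / P)
  have hzero : ∀ i : ℤ, -J ≤ i → i ≤ J → vecDtft x (i / P) = 0 := by
    intro i h1 h2
    have := hxt ⟨(i + J).toNat, by omega⟩
    have hc : (((i + J).toNat : ℕ) : ℝ) = i + J := by
      have : (((i + J).toNat : ℕ) : ℤ) = i + J := Int.toNat_of_nonneg (by omega)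
      exact_mod_cast this
    simpa [hc] using this
  have hbound : ∀ y ∈ Set.Icc (-W) W, ‖vecDtft x y‖ ≤ P * (q ^ M * ∑ n, ‖x n‖) := by
    intro y hy
    refine norm_vecDtft_le_of_samples (by omega) x y hq fun j hj => ?_
    rw [← hP]
    rcases le_or_gt j J with hjJ | hjJ
    · left
      have h1 := hzero (j : ℤ) (by omega) (by omega)
      rwa [Int.cast_natCast] at h1
    rcases le_or_gt (P - J) j with hjP | hjP
    · -- the samples just below frequency `1` are those just below frequency `0`
      left
      have h1 := hzero ((j : ℤ) - P) (by omega) (by omega)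
      rw [← vecDtft_add_int x _ 1] at h1
      convert h1 using 2
      push_cast
      field_simp
      ring
    · right
      have h1 : W + a ≤ j / P := by
        rw [le_div_iff₀ hPpos, mul_comm]
        refine hJ.trans ?_
        exact_mod_cast hjJ
      have h2 : (j : ℝ) / P ≤ 1 - (W + a) := by
        rw [div_le_iff₀ hPpos, sub_mul, one_mul, mul_comm]
        have : (j : ℝ) + J + 1 ≤ P := by exact_mod_cast (by omega : j + J + 1 ≤ P)
        linarith
      exact abs_cos_le_of_mem ha (by linarith [hy.2]) (by linarith [hy.1])
  have hS : (∑ n, ‖x n‖) ^ 2 ≤ N * ∑ n, ‖x n‖ ^ 2 := by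
    simpa using sq_sum_le_card_mul_sum_sq (s := Finset.univ) (f := fun n => ‖x n‖)
  have hWW : -W ≤ W := by linarith
  have hint : ∫ f in (-W)..W, ‖vecDtft x f‖ ^ 2 ≤ (P * (q ^ M * ∑ n, ‖x n‖)) ^ 2 := by
    calc ∫ f in (-W)..W, ‖vecDtft x f‖ ^ 2
        ≤ ∫ _ in (-W)..W, (P * (q ^ M * ∑ n, ‖x n‖)) ^ 2 := by
          refine intervalIntegral.integral_mono_on hWW ?_ ?_ ?_
          · apply Continuous.intervalIntegrable
            fun_prop
          · exact intervalIntegrable_const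
          · intro y hy
            exact pow_le_pow_left₀ (norm_nonneg _) (hbound y hy) 2
      _ = (W - -W) * (P * (q ^ M * ∑ n, ‖x n‖)) ^ 2 := by simp
      _ ≤ _ := mul_le_of_le_one_left (by positivity) (by linarith)
  refine le_of_mul_le_mul_right (hxl.trans (hint.trans ?_)) hx0
  calc (P * (q ^ M * ∑ n, ‖x n‖)) ^ 2 = (P * q ^ M) ^ 2 * (∑ n, ‖x n‖) ^ 2 := by ring
    _ ≤ (P * q ^ M) ^ 2 * (N * ∑ n, ‖x n‖ ^ 2) := by gcongr
    _ = _ := by ring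

/-- The eigenvalues of index at least `2 N W (1 + ε)` decay exponentially. The factor `N ^ 3` in
the explicit bound is absorbed by half of the exponential rate for large `N`, so that the leading
constant can be taken to be `1`. -/
theorem exists_decay {L : ℕ} {ε : ℝ} (hε : 0 < ε) (hεL : ε < (L : ℝ) - 1) :
    ∃ C₄ : ℝ, 0 < C₄ ∧ ∃ N₁ : ℕ, DPSSEigenvalueDecay (1 / (2 * (L : ℝ))) ε 1 C₄ N₁ := by
  have hL : (1 : ℝ) < L := by linarith
  set W := 1 / (2 * (L : ℝ)) with hWdef
  have hW : 0 < W := by positivity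
  have hW' : W ≤ 1 / 2 := by
    apply one_div_le_one_div_of_le <;> linarith
  -- with oversampling by `1 + η` and a band widened by `1 + η`, the number of zeros is at most
  -- `2 N W (1 + η) ^ 2 + 1`, where `(1 + η) ^ 2 ≤ 1 + ε / 2`
  set η := min 1 (ε / 6) with hη
  have hη0 : 0 < η := lt_min one_pos (by positivity)
  have hη1 : η ≤ 1 := min_le_left _ _
  have hη2 : (1 + η) ^ 2 ≤ 1 + ε / 2 := by
    have : η ≤ ε / 6 := min_le_right _ _
    nlinarith
  have ha : 0 < η * W := by positivity
  have ha' : η * W ≤ 1 / 2 := by nlinarith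
  set q := Real.cos (Real.pi * (η * W)) with hq
  have hηW : η * W < 1 / 2 := by
    have : W < 1 / 2 := by
      apply one_div_lt_one_div_of_lt <;> linarith
    nlinarith
  have hq0 : 0 < q := by
    apply Real.cos_pos_of_mem_Ioo
    constructor <;> nlinarith [Real.pi_pos]
  have hq1 : q < 1 := by
    rw [hq, ← Real.cos_zero]
    apply Real.cos_lt_cos_of_nonneg_of_le_pi le_rfl <;> nlinarith [Real.pi_pos]
  set b := -Real.log q with hb
  have hb0 : 0 < b := neg_pos.2 (Real.log_neg hq0 hq1)
  have hqb : q = Real.exp (-b) := by rw [hb, neg_neg, Real.exp_log hq0]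
  refine ⟨b * η, by positivity, ?_⟩
  have hlim : Filter.Tendsto (fun N : ℕ => 4 * Real.exp (2 * b) *
      ((N : ℝ) ^ 3 / Real.exp (b * η * N))) Filter.atTop (nhds 0) := by
    have h1 := (isLittleO_pow_exp_pos_mul_atTop 3 (b := b * η) (by positivity)).tendsto_div_nhds_zero
    have h2 := (h1.comp tendsto_natCast_atTop_atTop).const_mul (4 * Real.exp (2 * b))
    simpa using h2
  obtain ⟨N₂, hN₂⟩ := Filter.eventually_atTop.1
    ((hlim.eventually (ge_mem_nhds one_pos)).and
      ((tendsto_natCast_atTop_atTop (R := ℝ)).eventually_ge_atTop (1 / (W * ε))))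
  refine ⟨N₂, fun N hN s lam h l hl hlN => ?_⟩
  obtain ⟨hN1, hN2⟩ := hN₂ N hN
  have hN0 : (0 : ℝ) ≤ N := Nat.cast_nonneg N
  set M := ⌊η * N⌋₊ with hM
  have hMle : (M : ℝ) ≤ η * N := Nat.floor_le (by positivity)
  have hMge : η * N < M + 1 := Nat.lt_floor_add_one _
  have hP : ((N + M : ℕ) : ℝ) ≤ N * (1 + η) := by push_cast; linarith
  set J := ⌊((N + M : ℕ) : ℝ) * (W + η * W)⌋₊ with hJ
  have hJle : (J : ℝ) ≤ ((N + M : ℕ) : ℝ) * (W + η * W) := Nat.floor_le (by positivity)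
  have hJl : 2 * J + 1 ≤ l := by
    have h1 : (J : ℝ) ≤ N * W * (1 + ε / 2) := by
      calc (J : ℝ) ≤ (N * (1 + η)) * (W + η * W) := hJle.trans (by gcongr)
        _ = N * W * (1 + η) ^ 2 := by ring
        _ ≤ _ := by gcongr
    have h2 : 1 ≤ N * (W * ε) := by
      rwa [div_le_iff₀ (by positivity)] at hN2
    have h3 : (2 * J + 1 : ℝ) ≤ l := by linarith
    exact_mod_cast h3
  have hmain := h.eigenvalue_le hW.le hW' ha.le ha' (Nat.lt_floor_add_one _).le hl hJl
  rw [one_mul]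
  refine hmain.trans ?_
  rw [← hq, hqb, ← Real.exp_nat_mul]
  have hexp : Real.exp (M * -b) ≤ Real.exp b * Real.exp (-(b * η * N)) := by
    rw [← Real.exp_add]
    apply Real.exp_le_exp.2
    nlinarith
  have hP2 : ((N + M : ℕ) : ℝ) ≤ 2 * N := hP.trans (by nlinarith)
  calc (N : ℝ) * (((N + M : ℕ) : ℝ) * Real.exp (M * -b)) ^ 2
      ≤ N * ((2 * N) * (Real.exp b * Real.exp (-(b * η * N)))) ^ 2 := by gcongr
    _ = (4 * Real.exp (2 * b) * ((N : ℝ) ^ 3 / Real.exp (b * η * N))) *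
          Real.exp (-(b * η) * N) := by
        rw [div_eq_mul_inv, ← Real.exp_neg, two_mul b, Real.exp_add, neg_mul (b * η)]
        ring
    _ ≤ 1 * Real.exp (-(b * η) * N) := by gcongr
    _ = _ := one_mul _

/-! ### The approximation error -/

theorem frobenius_norm_sq {m n : Type*} [Fintype m] [Fintype n] (A : Matrix m n ℂ) :
    ‖A‖ ^ 2 = ∑ i, ∑ j, ‖A i j‖ ^ 2 := by
  have h0 : 0 ≤ ∑ i, ∑ j, ‖A i j‖ ^ 2 :=
    Finset.sum_nonneg fun _ _ => Finset.sum_nonneg fun _ _ => by positivity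
  rw [Matrix.frobenius_norm_def]
  simp_rw [Real.rpow_two]
  rw [← Real.sqrt_eq_rpow, Real.sq_sqrt h0]

/-- A row of the approximation error has DPSS coefficients `0` below `k`, and those of the row
itself from `k` on. -/
theorem IsDPSS.sum_normSq_approxError {L r k : ℕ} {W : ℝ} {s : ℕ → ℤ → ℝ} {lam : ℕ → ℝ}
    (h : IsDPSS r W s lam) (hk : k ≤ r) (X : Matrix (Fin L) (Fin r) ℂ) (i : Fin L) :
    ∑ n, ‖approxError X (dpssMatrix r k s) i n‖ ^ 2 =
      ∑ m : Fin r, if (m : ℕ) < k then 0 else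
        ‖inner ℂ (dpssVec r s m) (WithLp.toLp 2 (X i))‖ ^ 2 := by
  set x : EuclideanSpace ℂ (Fin r) := WithLp.toLp 2 (X i) with hx
  have hrow : WithLp.toLp 2 (approxError X (dpssMatrix r k s) i) =
      x - ∑ l : Fin k, (inner ℂ (dpssVec r s (Fin.castLE hk l)) x : ℂ) •
        dpssVec r s (Fin.castLE hk l) := by
    ext n
    simp [approxError, dpssMatrix, Matrix.mul_apply, dpssVec, hx, PiLp.inner_apply]
  have hin : ∀ m : Fin r,
      inner ℂ (dpssVec r s m) (WithLp.toLp 2 (approxError X (dpssMatrix r k s) i)) =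
        if (m : ℕ) < k then 0 else inner ℂ (dpssVec r s m) x := by
    intro m
    rw [hrow, inner_sub_right, inner_sum]
    simp_rw [inner_smul_right, orthonormal_iff_ite.1 h.orthonormal]
    split_ifs with hm
    · rw [Finset.sum_eq_single ⟨m, hm⟩]
      · simp
      · intro l _ hl
        rw [if_neg, mul_zero]
        rintro rfl
        exact hl rfl
      · simp
    · rw [Finset.sum_eq_zero, sub_zero]
      intro l _
      rw [if_neg, mul_zero]
      rintro rfl
      exact hm l.2
  have := h.sum_sq_norm_inner (WithLp.toLp 2 (approxError X (dpssMatrix r k s) i))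
  rw [← this]
  refine Finset.sum_congr rfl fun m _ => ?_
  rw [hin]
  split_ifs <;> simp

theorem dictSize_le {L r : ℕ} {ε : ℝ} (hε : 0 < ε) (hεL : ε < (L : ℝ) - 1) :
    dictSize r (1 / (2 * (L : ℝ))) ε ≤ r := by
  have hL : (0 : ℝ) < L := by linarith
  unfold dictSize
  apply Nat.ceil_le.2
  have : 2 * (r : ℝ) * (1 / (2 * (L : ℝ))) * (1 + ε) = r * ((1 + ε) / L) := by
    field_simp
  rw [this]
  have h1 : (1 + ε) / L ≤ 1 := by
    rw [div_le_one hL]; linarith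
  exact mul_le_of_le_one_right (Nat.cast_nonneg r) h1

/-- If a vector has all but a fraction `δ` of its energy in the band, its DPSS coefficients from
`k` on carry at most a fraction `δ + β` of its energy, where `β` bounds the eigenvalues
from `k` on: the missing energy is `∑ (1 - λ_m) |c_m|²`, with nonnegative terms. -/
theorem IsDPSS.tail_energy_le {r k : ℕ} {W : ℝ} {s : ℕ → ℤ → ℝ} {lam : ℕ → ℝ}
    (h : IsDPSS r W s lam) (hW : 0 ≤ W) (hW' : W ≤ 1 / 2) {β δ : ℝ}
    (hβ : 0 ≤ β) (hlam : ∀ m < r, k ≤ m → lam m ≤ β) (x : EuclideanSpace ℂ (Fin r))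
    (hx : (1 - δ) * seqEnergy (zeroExtend x) ≤ seqEnergy (bandLimit W (zeroExtend x))) :
    (∑ m : Fin r, if (m : ℕ) < k then 0 else ‖inner ℂ (dpssVec r s m) x‖ ^ 2) ≤
      (δ + β) * ∑ n, ‖x n‖ ^ 2 := by
  rw [seqEnergy_zeroExtend, ← h.sum_sq_norm_inner] at hx
  have h1 := hx.trans (seqEnergy_bandLimit_le hW hW' x)
  rw [h.integral_normSq_vecDtft] at h1
  rw [← h.sum_sq_norm_inner]
  have h2 : ∀ m : Fin r, (if (m : ℕ) < k then 0 else ‖inner ℂ (dpssVec r s m) x‖ ^ 2) ≤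
      (1 + β) * ‖inner ℂ (dpssVec r s m) x‖ ^ 2 - lam m * ‖inner ℂ (dpssVec r s m) x‖ ^ 2 := by
    intro m
    have h0 : 0 ≤ ‖inner ℂ (dpssVec r s m) x‖ ^ 2 := by positivity
    have hl := h.lt_one m m.2
    split_ifs with hm
    · nlinarith
    · have := hlam m m.2 (not_lt.1 hm)
      nlinarith
  have h3 := Finset.sum_le_sum fun (m : Fin r) (_ : m ∈ Finset.univ) => h2 m
  rw [Finset.sum_sub_distrib, ← Finset.mul_sum] at h3
  linarith

theorem norm_approxError_le {L : ℕ} {ε : ℝ} (hε : 0 < ε) (hεL : ε < (L : ℝ) - 1)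
    {C₃ C₄ : ℝ} {N₁ : ℕ} (hC : DPSSEigenvalueDecay (1 / (2 * (L : ℝ))) ε C₃ C₄ N₁)
    {r : ℕ} (hr : N₁ ≤ r) {s : ℕ → ℤ → ℝ} {lam : ℕ → ℝ}
    (h : IsDPSS r (1 / (2 * (L : ℝ))) s lam) {δ : ℝ} {X : Matrix (Fin L) (Fin r) ℂ}
    (hX : ∀ i : Fin L, (1 - δ) * seqEnergy (zeroExtend (X i)) ≤
      seqEnergy (bandLimit (1 / (2 * (L : ℝ))) (zeroExtend (X i)))) :
    ‖approxError X (dpssMatrix r (dictSize r (1 / (2 * (L : ℝ))) ε) s)‖ ≤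
      Real.sqrt (L * (δ + r * C₃ * Real.exp (-C₄ * r))) * ‖X‖ := by
  have hL : (1 : ℝ) < L := by linarith
  have hk := dictSize_le (r := r) hε hεL
  set k := dictSize r (1 / (2 * (L : ℝ))) ε with hkdef
  set E := approxError X (dpssMatrix r k s) with hE
  set K := δ + r * C₃ * Real.exp (-C₄ * r) with hK
  have hW : 0 ≤ 1 / (2 * (L : ℝ)) := by positivity
  have hW' : 1 / (2 * (L : ℝ)) ≤ 1 / 2 := by
    apply one_div_le_one_div_of_le <;> linarith
  -- rounding up may give `k = r`; the dictionary is then complete, and no eigenvalue shows that the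
  -- constant is nonnegative
  rcases hk.eq_or_lt with hkr | hkr
  · have hE0 : ‖E‖ ^ 2 = 0 := by
      rw [frobenius_norm_sq]
      refine Finset.sum_eq_zero fun i _ => ?_
      rw [hE, h.sum_normSq_approxError hk]
      exact Finset.sum_eq_zero fun m _ => if_pos (m.2.trans_eq hkr.symm)
    rw [pow_eq_zero_iff two_ne_zero] at hE0
    rw [hE0]
    positivity
  · have hdecay : ∀ m < r, k ≤ m → lam m ≤ C₃ * Real.exp (-C₄ * r) := fun m hm hkm =>
      hC r hr s lam h m hm (Nat.ceil_le.1 hkm)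
    have hβ : 0 ≤ C₃ * Real.exp (-C₄ * r) := (h.pos k hkr).le.trans (hdecay k hkr le_rfl)
    have hr1 : (1 : ℝ) ≤ r := by exact_mod_cast (by omega : 1 ≤ r)
    have hrow : ∀ i, ∑ n, ‖E i n‖ ^ 2 ≤ K * ∑ n, ‖X i n‖ ^ 2 := by
      intro i
      rw [hE, h.sum_normSq_approxError hk]
      refine (h.tail_energy_le hW hW' hβ hdecay (WithLp.toLp 2 (X i)) (hX i)).trans ?_
      refine mul_le_mul_of_nonneg_right ?_ (Finset.sum_nonneg fun _ _ => by positivity)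
      rw [hK, mul_assoc]
      nlinarith
    have hsq : ‖E‖ ^ 2 ≤ K * ‖X‖ ^ 2 := by
      rw [frobenius_norm_sq, frobenius_norm_sq, Finset.mul_sum]
      exact Finset.sum_le_sum fun i _ => hrow i
    rcases le_or_gt 0 K with hK0 | hK0
    · rw [← Real.sqrt_sq (norm_nonneg X), ← Real.sqrt_mul (by positivity)]
      apply Real.le_sqrt_of_sq_le
      have : 0 ≤ K * ‖X‖ ^ 2 := by positivity
      nlinarith
    · -- a negative constant forces the error to vanish
      have : ‖E‖ ^ 2 ≤ 0 := hsq.trans (mul_nonpos_of_nonpos_of_nonneg hK0.le (by positivity))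
      have hE0 : ‖E‖ = 0 := by
        rw [← pow_eq_zero_iff two_ne_zero]
        exact le_antisymm this (by positivity)
      rw [hE0]
      positivity

theorem mainTheorem3 :
    -- constants for the eigenvalue decay exist, with `C₃` independent of `L` and `ε`
    (∃ C₃ : ℝ, 0 < C₃ ∧ ∀ (L : ℕ) (ε : ℝ), 0 < ε → ε < (L : ℝ) - 1 →
      ∃ C₄ : ℝ, 0 < C₄ ∧ ∃ N₁ : ℕ, DPSSEigenvalueDecay (1 / (2 * (L : ℝ))) ε C₃ C₄ N₁) ∧
    -- and all such constants are admissible in the error bound (Frobenius norms)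
    (∀ (L : ℕ) (ε : ℝ), 0 < ε → ε < (L : ℝ) - 1 →
      ∀ (C₃ C₄ : ℝ) (N₁ : ℕ), DPSSEigenvalueDecay (1 / (2 * (L : ℝ))) ε C₃ C₄ N₁ →
      ∀ r : ℕ, N₁ ≤ r →
      ∀ (s : ℕ → ℤ → ℝ) (lam : ℕ → ℝ), IsDPSS r (1 / (2 * (L : ℝ))) s lam →
      ∀ (δ : ℝ) (X : Matrix (Fin L) (Fin r) ℂ),
        (∀ i : Fin L, (1 - δ) * seqEnergy (zeroExtend (X i)) ≤
          seqEnergy (bandLimit (1 / (2 * (L : ℝ))) (zeroExtend (X i)))) →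
        ‖approxError X (dpssMatrix r (dictSize r (1 / (2 * (L : ℝ))) ε) s)‖ ≤
          Real.sqrt (L * (δ + r * C₃ * Real.exp (-C₄ * r))) * ‖X‖) := by
  refine ⟨⟨1, one_pos, fun L ε hε hεL => exists_decay hε hεL⟩, ?_⟩
  intro L ε hε hεL C₃ C₄ N₁ hC r hr s lam h δ X hX
  exact norm_approxError_le hε hεL hC hr h hX
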